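/- Let $S$ be a set and let coefficients $m_{s,t}=m_{t,s}\in\{2,3,\ldots\}\cup\{\infty\}$ be given for all $s\neq t$ in $S$. The associated Artin group is the group generated by $S$ subject to the relations $\underbrace{sts\cdots}_{m_{s,t}}=\underbrace{tst\cdots}_{m_{s,t}}$ for all $s\neq t$ with $m_{s,t}<\infty$, and the associated Coxeter group is its quotient by the normal subgroup generated by $\{s^2 : s\in S\}$. Each is equipped with its word metric $d$ with respect to $S$: $d(x,y)$ is the least length of a word in the letters $S\cup S^{-1}$ representing $x^{-1}y$. A hermitian kernel $K\colon X\times X\to\mathbb{C}$ on a set $X$ is called conditionally strictly negative definite if $\sum_{x,y\in X}\lambda(x)\overline{\lambda(y)}K(x,y)<0$ for every nonzero finitely supported $\lambda\colon X\to\mathbb{C}$ with $\sum_{x\in X}\lambda(x)=0$. Then the word metric on the Coxeter group is conditionally strictly negative definite if and only if this group is a free Coxeter group, i.e. isomorphic to a free product of copies of $\mathbb{Z}/2\mathbb{Z}$. Likewise, the word metric on the Artin group is conditionally strictly negative definite if and only if this group is free. -/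

import Mathlib

section Kernels

open scoped ComplexOrder

/-- A complex-valued kernel `K` on a set `X` is *conditionally strictly negative definite* if it is
hermitian and `∑ x, ∑ y, l x * conj (l y) * K x y < 0` for every nonzero finitely supported
`l : X → ℂ` with `∑ x, l x = 0`. (For complex numbers, `z < 0` means that `z` is real and
negative.) -/
def IsCondStrictlyNegDef {X : Type*} (K : X → X → ℂ) : Prop :=
  (∀ x y, K x y = (starRingEnd ℂ) (K y x)) ∧
    ∀ l : X →₀ ℂ, l ≠ 0 → ∑ x ∈ l.support, l x = 0 →
      ∑ x ∈ l.support, ∑ y ∈ l.support, l x * (starRingEnd ℂ) (l y) * K x y < 0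

end Kernels

/-- The word length of `g` with respect to a generating set `S`: the least length of a word in
the letters `S ∪ S⁻¹` whose product is `g`. -/
noncomputable def wordLength {G : Type*} [Group G] (S : Set G) (g : G) : ℕ :=
  sInf {n | ∃ w : List G, (∀ a ∈ w, a ∈ S ∨ a⁻¹ ∈ S) ∧ w.prod = g ∧ w.length = n}

/-- The word metric of a group with respect to a generating set `S`, that is, the path metric of
the Cayley graph of the group with respect to `S`. -/
noncomputable def wordDist {G : Type*} [Group G] (S : Set G) (x y : G) : ℕ :=
  wordLength S (x⁻¹ * y)

/-- The alternating product `s * t * s * ⋯` with `k` factors, starting with `s`. -/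
def altProd {G : Type*} [Monoid G] (s t : G) : ℕ → G
  | 0 => 1
  | k + 1 => s * altProd t s k

/-- The defining relators of the Artin group with coefficients `M`: for distinct `s`, `t` with
`M s t` finite, the words `s * t * s * ⋯` and `t * s * t * ⋯` with `M s t` letters each are
identified. The entry `0` of a Coxeter matrix stands for `∞` (no relation). -/
def artinRelators {B : Type*} (M : CoxeterMatrix B) : Set (FreeGroup B) :=
  {r | ∃ s t : B, s ≠ t ∧ M s t ≠ 0 ∧
    r = altProd (FreeGroup.of s) (FreeGroup.of t) (M s t) *
      (altProd (FreeGroup.of t) (FreeGroup.of s) (M s t))⁻¹}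

/-- The Artin group with generating set `B` and coefficients `M`. -/
abbrev ArtinGroup {B : Type*} (M : CoxeterMatrix B) : Type _ :=
  PresentedGroup (artinRelators M)

/-- The standard generators of the Artin group. -/
def artinGenerators {B : Type*} (M : CoxeterMatrix B) : Set (ArtinGroup M) :=
  Set.range (PresentedGroup.of (rels := artinRelators M))

/-- A group is a *free Coxeter group* if it is isomorphic to a free product of copies of
`ℤ/2ℤ`. -/
def IsFreeCoxeterGroup.{u} (G : Type u) [Group G] : Prop :=
  ∃ I : Type u, Nonempty (G ≃* Monoid.CoprodI (fun _ : I => Multiplicative (ZMod 2)))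

/-!
For both groups, the word metric is conditionally strictly negative definite exactly if no
off-diagonal coefficient is finite, and this is also exactly the condition for the group to be free
(for the Artin group) or a free product of copies of `ℤ/2ℤ` (for the Coxeter group).

If all coefficients are infinite, the Cayley graph is a tree. A tree metric is a sum over the edges
of the kernels `|1_e(x) - 1_e(y)|`, where `1_e` is the indicator function of the points beyond `e`,
so that `∑ λ(x) λ̄(y) d(x, y) = -2 ∑_e |∑_{x beyond e} λ(x)|²` for weights `λ` of sum zero; this is
nonzero by the contribution of the last edge on the way to a deepest point of the support
(`isCondStrictlyNegDef_card_symmDiff`). Both groups are treated at once by their action on reduced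
words (`ReducedWordAction`).

If `s ≠ t` have a finite coefficient `m`, the Cayley graph contains a cycle of length `2m` on which
antipodal points have distance `m`, and four points of such a cycle violate strictness
(`not_isCondStrictlyNegDef_wordDist`). That the alternating product of length `m` has word length
`m` in the Coxeter group, and hence in the Artin group above it, combines two facts: the product of
`s` and `t` has order exactly `m`, by the geometric representation, and the number of inversions,
counted modulo `2` by the action on `W × ℤ/2ℤ`, is a lower bound for the length
(`CoxeterMatrix.le_length_of_prod_eq_altProd`).

A finite coefficient also prevents the groups from being abstractly free. In a free product of
copies of `ℤ/2ℤ`, nontrivial torsion elements have odd length, which cannot hold for all of `s`, `t`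
and `st` (`CoxeterMatrix.forall_eq_zero_of_isFreeCoxeterGroup`). In the Artin group, `(st)^m =
(ts)^m`; were it free, uniqueness of roots would make `s` and `t` commute, hence be powers of a
common element (`ArtinGroup.forall_eq_zero_of_isFreeGroup`).
-/

/-! ### Negative definite kernels -/

section NegDefKernels

open scoped ComplexOrder

/-- The kernel `#(A x ∆ A y)` is conditionally strictly negative definite if every `x` has an
element `top x` of `A x` which belongs only to those other sets `A y` that are larger than `A x`.
Here `A x` is to be thought of as the set of vertices on the path from a base point of a tree to
`x`, each standing for the edge that leads to it, and `top x` as the last of them. -/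
theorem isCondStrictlyNegDef_card_symmDiff {X E : Type*} [DecidableEq E] (A : X → Finset E)
    (top : X → E) (htop : ∀ x, top x ∈ A x)
    (hlt : ∀ x y, top x ∈ A y → x = y ∨ (A x).card < (A y).card) :
    IsCondStrictlyNegDef (fun x y : X => ((symmDiff (A x) (A y)).card : ℂ)) := by
  classical
  refine ⟨fun x y => by simp [symmDiff_comm], fun l hl hsum => ?_⟩
  set T := l.support with hT
  set E₀ := T.biUnion A with hE₀
  let ind : E → X → ℂ := fun e x => if e ∈ A x then 1 else 0
  -- `L e` is the total mass of the points lying beyond the edge `e`.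
  let L : E → ℂ := fun e => ∑ x ∈ T, l x * ind e x
  have hcard : ∀ x ∈ T, ∀ y ∈ T, ((symmDiff (A x) (A y)).card : ℂ) =
      ∑ e ∈ E₀, (ind e x + ind e y - 2 * (ind e x * ind e y)) := by
    intro x hx y hy
    have hsub : symmDiff (A x) (A y) ⊆ E₀ := by
      intro e he
      rw [Finset.mem_symmDiff] at he
      rw [hE₀, Finset.mem_biUnion]
      rcases he with h | h
      exacts [⟨x, hx, h.1⟩, ⟨y, hy, h.1⟩]
    rw [← Finset.inter_eq_right.mpr hsub, ← Finset.filter_mem_eq_inter, Finset.card_filter]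
    push_cast
    refine Finset.sum_congr rfl fun e _ => ?_
    by_cases h₁ : e ∈ A x <;> by_cases h₂ : e ∈ A y <;>
      simp [ind, h₁, h₂, Finset.mem_symmDiff]; norm_num
  have hconj : ∑ y ∈ T, (starRingEnd ℂ) (l y) = 0 := by
    rw [← map_sum, hsum, map_zero]
  have hindc : ∀ e x, (starRingEnd ℂ) (ind e x) = ind e x := by
    intro e x; by_cases h : e ∈ A x <;> simp [ind, h]
  -- Each edge contributes `-2 * ‖L e‖ ^ 2`, since the total mass is zero.
  have hkey : ∑ x ∈ T, ∑ y ∈ T,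
      l x * (starRingEnd ℂ) (l y) * ((symmDiff (A x) (A y)).card : ℂ) =
      ((-2 * ∑ e ∈ E₀, ‖L e‖ ^ 2 : ℝ) : ℂ) := by
    have h1 : ∀ e, ∑ x ∈ T, ∑ y ∈ T, l x * (starRingEnd ℂ) (l y) *
        (ind e x + ind e y - 2 * (ind e x * ind e y)) = -2 * ((‖L e‖ : ℂ) ^ 2) := by
      intro e
      have h2 : ∀ x ∈ T, ∑ y ∈ T, l x * (starRingEnd ℂ) (l y) *
          (ind e x + ind e y - 2 * (ind e x * ind e y)) =
          l x * ind e x * ∑ y ∈ T, (starRingEnd ℂ) (l y) +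
          l x * (starRingEnd ℂ) (L e) - 2 * (l x * ind e x * (starRingEnd ℂ) (L e)) := by
        intro x _
        simp only [L, map_sum, map_mul, hindc, Finset.mul_sum]
        rw [← Finset.sum_add_distrib, ← Finset.sum_sub_distrib]
        exact Finset.sum_congr rfl fun y _ => by ring
      rw [Finset.sum_congr rfl h2, hconj]
      simp only [mul_zero, zero_add]
      rw [Finset.sum_sub_distrib, ← Finset.sum_mul, hsum, ← Finset.mul_sum, ← Finset.sum_mul,
        ← Complex.mul_conj']
      simp only [L]; ring
    calc _ = ∑ x ∈ T, ∑ y ∈ T, ∑ e ∈ E₀, l x * (starRingEnd ℂ) (l y) *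
        (ind e x + ind e y - 2 * (ind e x * ind e y)) := by
          refine Finset.sum_congr rfl fun x hx => Finset.sum_congr rfl fun y hy => ?_
          rw [hcard x hx y hy, Finset.mul_sum]
      _ = ∑ e ∈ E₀, ∑ x ∈ T, ∑ y ∈ T, l x * (starRingEnd ℂ) (l y) *
        (ind e x + ind e y - 2 * (ind e x * ind e y)) := by
          exact (Finset.sum_congr rfl fun x _ => Finset.sum_comm).trans Finset.sum_comm
      _ = _ := by
          rw [Finset.sum_congr rfl fun e _ => h1 e]
          push_cast
          rw [Finset.mul_sum]
  rw [hkey]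
  -- Only one point of the support lies beyond the last edge of a point of maximal depth.
  obtain ⟨x, hx, hmax⟩ := Finset.exists_max_image T (fun x => (A x).card)
    (Finsupp.support_nonempty_iff.mpr hl)
  have hLx : L (top x) = l x := by
    simp only [L]
    rw [Finset.sum_eq_single_of_mem x hx]
    · simp [ind, htop]
    · intro y hy hne
      have : top x ∉ A y := fun h => by
        rcases hlt x y h with h | h
        · exact hne h.symm
        · exact absurd (hmax y hy) (not_le.mpr h)
      simp [ind, this]
  have hpos : 0 < ∑ e ∈ E₀, ‖L e‖ ^ 2 := by
    refine Finset.sum_pos' (fun _ _ => by positivity) ⟨top x, ?_, ?_⟩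
    · exact Finset.mem_biUnion.mpr ⟨x, hx, htop x⟩
    · rw [hLx]
      have : l x ≠ 0 := Finsupp.mem_support_iff.mp hx
      positivity
  have : (-2 * ∑ e ∈ E₀, ‖L e‖ ^ 2 : ℝ) < 0 := by linarith
  exact_mod_cast this

/-- Four points placed like two pairs of antipodal points `a`, `c` and `b`, `e` of a cycle of length
`2 * m`, with `b` next to `a` and `e` next to `c`, violate strictness: the alternating weights
`1, -1, 1, -1` give a nonnegative sum. -/
theorem not_isCondStrictlyNegDef_of_quadrilateral {X : Type*} (d : X → X → ℕ)
    (hself : ∀ x, d x x = 0) (hsymm : ∀ x y, d x y = d y x) {a b c e : X} {m : ℕ} (hm : 2 ≤ m)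
    (hab : d a b ≤ 1) (hce : d c e ≤ 1) (hbc : d b c + 1 ≤ m) (hae : d a e + 1 ≤ m)
    (hac : m ≤ d a c) (hbe : m ≤ d b e) :
    ¬ IsCondStrictlyNegDef (fun x y : X => (d x y : ℂ)) := by
  classical
  rintro ⟨-, h⟩
  have n1 : a ≠ b := by rintro rfl; omega
  have n2 : a ≠ c := by rintro rfl; rw [hself] at hac; omega
  have n3 : a ≠ e := by rintro rfl; rw [hsymm] at hbe; omega
  have n4 : b ≠ c := by rintro rfl; omega
  have n5 : b ≠ e := by rintro rfl; rw [hself] at hbe; omega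
  have n6 : c ≠ e := by rintro rfl; omega
  let l : X →₀ ℂ := Finsupp.single a 1 - Finsupp.single b 1 + Finsupp.single c 1 -
    Finsupp.single e 1
  have la : l a = 1 := by simp [l, n1.symm, n2.symm, n3.symm]
  have lb : l b = -1 := by simp [l, n1, n4.symm, n5.symm]
  have lc : l c = 1 := by simp [l, n2, n4, n6.symm]
  have le : l e = -1 := by simp [l, n3, n5, n6]
  have hsupp : l.support = {a, b, c, e} := by
    ext x
    rw [Finsupp.mem_support_iff]
    constructor
    · intro hx
      by_contra hx'
      simp only [Finset.mem_insert, Finset.mem_singleton, not_or] at hx'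
      obtain ⟨h1, h2, h3, h4⟩ := hx'
      exact hx (by simp [l, Ne.symm h1, Ne.symm h2, Ne.symm h3, Ne.symm h4])
    · simp only [Finset.mem_insert, Finset.mem_singleton]
      rintro (rfl | rfl | rfl | rfl) <;> simp [la, lb, lc, le]
  have hsum : ∀ F : X → ℂ, ∑ x ∈ ({a, b, c, e} : Finset X), F x = F a + F b + F c + F e := by
    intro F
    rw [Finset.sum_insert, Finset.sum_insert, Finset.sum_insert, Finset.sum_singleton]
    · ring
    all_goals simp [*]
  have := h l (fun h0 => by rw [h0] at la; simp at la)
    (by rw [hsupp, hsum, la, lb, lc, le]; ring)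
  rw [hsupp] at this
  simp only [hsum, la, lb, lc, le, map_one, map_neg, hself, hsymm b a, hsymm c a, hsymm e a,
    hsymm c b, hsymm e b, hsymm e c] at this
  have key : ((2 * ((d a c : ℝ) + d b e - d a b - d a e - d b c - d c e) : ℝ) : ℂ) < 0 := by
    convert this using 1
    push_cast; ring
  have key' : 2 * ((d a c : ℝ) + d b e - d a b - d a e - d b c - d c e) < 0 := by
    exact_mod_cast key
  have : (d a b : ℝ) + d c e + (d b c + 1) + (d a e + 1) ≤ 1 + 1 + m + m := by
    exact_mod_cast (by omega : d a b + d c e + (d b c + 1) + (d a e + 1) ≤ 1 + 1 + m + m)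
  have h2 : (m : ℝ) + m ≤ d a c + d b e := by exact_mod_cast (by omega : m + m ≤ d a c + d b e)
  linarith

end NegDefKernels

/-! ### Word metrics -/

section WordMetric

variable {G : Type*} [Group G] {S : Set G}

theorem wordLength_le {w : List G} (hw : ∀ a ∈ w, a ∈ S ∨ a⁻¹ ∈ S) :
    wordLength S w.prod ≤ w.length :=
  Nat.sInf_le ⟨w, hw, rfl, rfl⟩

theorem exists_word_of_closure_eq_top (hS : Subgroup.closure S = ⊤) (g : G) :
    ∃ w : List G, (∀ a ∈ w, a ∈ S ∨ a⁻¹ ∈ S) ∧ w.prod = g := by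
  have hg : g ∈ (Subgroup.closure S).toSubmonoid := by rw [hS]; trivial
  rw [Subgroup.closure_toSubmonoid] at hg
  simpa using Submonoid.exists_list_of_mem_closure hg

theorem exists_word_length_eq_wordLength (hS : Subgroup.closure S = ⊤) (g : G) :
    ∃ w : List G, (∀ a ∈ w, a ∈ S ∨ a⁻¹ ∈ S) ∧ w.prod = g ∧ w.length = wordLength S g := by
  obtain ⟨w, hw, hg⟩ := exists_word_of_closure_eq_top hS g
  exact Nat.sInf_mem (s := {n | ∃ w : List G, (∀ a ∈ w, a ∈ S ∨ a⁻¹ ∈ S) ∧ w.prod = g ∧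
    w.length = n}) ⟨w.length, w, hw, hg, rfl⟩

theorem wordDist_self (x : G) : wordDist S x x = 0 := by
  have := wordLength_le (S := S) (w := []) (by simp)
  simpa [wordDist] using this

theorem wordLength_inv_le (hS : Subgroup.closure S = ⊤) (g : G) :
    wordLength S g⁻¹ ≤ wordLength S g := by
  obtain ⟨w, hw, hg, hl⟩ := exists_word_length_eq_wordLength hS g
  have h := wordLength_le (S := S) (w := (w.map (·⁻¹)).reverse) (by
    intro a ha
    simp only [List.mem_reverse, List.mem_map] at ha
    obtain ⟨b, hb, rfl⟩ := ha
    simpa [or_comm] using hw b hb)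
  rw [← List.prod_inv_reverse, hg] at h
  simpa [hl] using h

theorem wordDist_comm (hS : Subgroup.closure S = ⊤) (x y : G) :
    wordDist S x y = wordDist S y x := by
  unfold wordDist
  apply le_antisymm
  · simpa using wordLength_inv_le hS (y⁻¹ * x)
  · simpa using wordLength_inv_le hS (x⁻¹ * y)

end WordMetric

/-! ### Reduced words -/

section ReducedWords

variable {α : Type*} {inv : α → α}

/-- A list of letters is reduced with respect to an inversion `inv` of the alphabet if no letter is
followed by its inverse. -/
def IsReducedWord (inv : α → α) (L : List α) : Prop :=
  L.IsChain fun a b => b ≠ inv a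

/-- Multiplication of a reduced word by a letter on the left, with free cancellation. -/
def consReduce [DecidableEq α] (inv : α → α) (a : α) : List α → List α
  | [] => [a]
  | b :: L => if b = inv a then L else a :: b :: L

variable [DecidableEq α]

theorem consReduce_cons (a b : α) (L : List α) :
    consReduce inv a (b :: L) = if b = inv a then L else a :: b :: L :=
  rfl

theorem IsReducedWord.consReduce {L : List α} (hL : IsReducedWord inv L) (a : α) :
    IsReducedWord inv (consReduce inv a L) := by
  cases L with
  | nil => exact List.isChain_singleton a
  | cons b L =>
    rw [consReduce_cons]
    split_ifs with h
    · exact List.IsChain.tail hL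
    · exact List.isChain_cons_cons.mpr ⟨h, hL⟩

theorem consReduce_of_isReducedWord_cons {a : α} {L : List α} (h : IsReducedWord inv (a :: L)) :
    consReduce inv a L = a :: L := by
  cases L with
  | nil => rfl
  | cons b L => exact if_neg (List.isChain_cons_cons.mp h).1

/-- Left multiplication by a letter either adds the letter or removes its inverse. -/
theorem consReduce_eq_cons_or (a : α) (L : List α) :
    consReduce inv a L = a :: L ∨ L = inv a :: consReduce inv a L := by
  cases L with
  | nil => exact Or.inl rfl
  | cons b L =>
    rw [consReduce_cons]
    split_ifs with h
    · right; rw [h]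
    · exact Or.inl rfl

theorem consReduce_inv_consReduce (hinv : Function.Involutive inv) {L : List α}
    (hL : IsReducedWord inv L) (a : α) : consReduce inv (inv a) (consReduce inv a L) = L := by
  rcases consReduce_eq_cons_or (inv := inv) a L with h | h
  · rw [h]
    simp [consReduce, hinv a]
  · rw [h] at hL
    conv_rhs => rw [h]
    exact consReduce_of_isReducedWord_cons hL

/-- The permutation of the set of reduced words given by left multiplication by a letter. -/
def letterPerm (hinv : Function.Involutive inv) (a : α) :
    Equiv.Perm {L : List α // IsReducedWord inv L} where
  toFun L := ⟨consReduce inv a L.1, L.2.consReduce a⟩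
  invFun L := ⟨consReduce inv (inv a) L.1, L.2.consReduce _⟩
  left_inv L := Subtype.ext (consReduce_inv_consReduce hinv L.2 a)
  right_inv L := Subtype.ext (by
    have := consReduce_inv_consReduce hinv L.2 (inv a)
    rwa [hinv a] at this)

theorem letterPerm_inv (hinv : Function.Involutive inv) (a : α) :
    letterPerm hinv (inv a) = (letterPerm hinv a)⁻¹ := by
  ext L : 1
  rfl

end ReducedWords

/-- A *free action on reduced words* of a group `G`: a family of generators `letter a` of `G`,
closed under inversion, together with an action of `G` on the reduced words for which `letter a`
acts as left multiplication by the letter `a`. It exhibits `G` as a free product of copies of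
`ℤ` (pairs of letters `a ≠ inv a`) and of `ℤ/2ℤ` (letters `a = inv a`). -/
structure ReducedWordAction (G α : Type*) [Group G] [DecidableEq α] where
  /-- The inversion of the alphabet. -/
  inv : α → α
  inv_inv : Function.Involutive inv
  /-- The element of the group represented by a letter. -/
  letter : α → G
  letter_inv : ∀ a, letter (inv a) = (letter a)⁻¹
  closure_range_letter : Subgroup.closure (Set.range letter) = ⊤
  /-- The action of the group on reduced words. -/
  toPerm : G →* Equiv.Perm {L : List α // IsReducedWord inv L}
  toPerm_letter : ∀ a, toPerm (letter a) = letterPerm inv_inv a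

namespace ReducedWordAction

variable {G α : Type*} [Group G] [DecidableEq α] (A : ReducedWordAction G α)

/-- The normal form of an element: the reduced word obtained by letting it act on the empty
word. -/
def normalForm (g : G) : List α :=
  (A.toPerm g ⟨[], List.isChain_nil⟩).1

/-- The element of the group represented by a word. -/
def eval (L : List α) : G := (L.map A.letter).prod

@[simp] theorem eval_nil : A.eval [] = 1 := rfl

@[simp] theorem eval_cons (a : α) (L : List α) : A.eval (a :: L) = A.letter a * A.eval L := by
  simp [eval]

@[simp] theorem eval_append (L L' : List α) : A.eval (L ++ L') = A.eval L * A.eval L' := by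
  simp [eval]

theorem normalForm_one : A.normalForm 1 = [] := by
  simp [normalForm]

theorem isReducedWord_normalForm (g : G) : IsReducedWord A.inv (A.normalForm g) :=
  (A.toPerm g ⟨[], List.isChain_nil⟩).2

theorem normalForm_letter_mul (a : α) (g : G) :
    A.normalForm (A.letter a * g) = consReduce A.inv a (A.normalForm g) := by
  simp only [normalForm, map_mul, A.toPerm_letter]
  rfl

theorem eval_consReduce (a : α) (L : List α) :
    A.eval (consReduce A.inv a L) = A.letter a * A.eval L := by
  rcases consReduce_eq_cons_or (inv := A.inv) a L with h | h
  · rw [h, eval_cons]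
  · conv_rhs => rw [h]
    rw [eval_cons, A.letter_inv, mul_inv_cancel_left]

theorem eval_toPerm (g : G) (L : {L : List α // IsReducedWord A.inv L}) :
    A.eval (A.toPerm g L).1 = g * A.eval L.1 := by
  have hg : g ∈ Subgroup.closure (Set.range A.letter) := by
    rw [A.closure_range_letter]; trivial
  induction hg using Subgroup.closure_induction generalizing L with
  | mem x hx =>
    obtain ⟨a, rfl⟩ := hx
    rw [A.toPerm_letter]
    exact A.eval_consReduce a L.1
  | one => simp
  | mul x y _ _ hx hy => rw [map_mul, Equiv.Perm.mul_apply, hx, hy, mul_assoc]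
  | inv x _ hx =>
    have := hx (A.toPerm x⁻¹ L)
    rw [← Equiv.Perm.mul_apply, ← map_mul, mul_inv_cancel, map_one, Equiv.Perm.one_apply] at this
    rw [this, inv_mul_cancel_left]

theorem eval_normalForm (g : G) : A.eval (A.normalForm g) = g :=
  (A.eval_toPerm g ⟨[], List.isChain_nil⟩).trans (mul_one g)

theorem normalForm_injective : Function.Injective A.normalForm :=
  Function.LeftInverse.injective A.eval_normalForm

theorem normalForm_eval {L : List α} (hL : IsReducedWord A.inv L) :
    A.normalForm (A.eval L) = L := by
  induction L with
  | nil => exact A.normalForm_one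
  | cons a L ih =>
    rw [eval_cons, normalForm_letter_mul, ih (List.IsChain.tail hL),
      consReduce_of_isReducedWord_cons hL]

/-! ### The tree of reduced words -/

/-- The vertices on the path from the empty word to (the normal form of the inverse of) `g`.
The inverse turns the word metric, for which `x` and `x * s` are adjacent, into adjacency under left
multiplication by letters. -/
def path (g : G) : Finset (List α) := (A.normalForm g⁻¹).tails.toFinset

theorem normalForm_mem_path (g : G) : A.normalForm g⁻¹ ∈ A.path g := by
  simp [path]

theorem card_path (g : G) : (A.path g).card = (A.normalForm g⁻¹).length + 1 := by
  rw [path, List.toFinset_card_of_nodup, List.length_tails]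
  generalize A.normalForm g⁻¹ = L
  induction L with
  | nil => simp
  | cons a L ih =>
    simp only [List.tails_cons, List.nodup_cons, List.mem_tails, ih, and_true]
    intro h
    simpa using h.length_le

theorem eq_or_card_path_lt {x y : G} (h : A.normalForm x⁻¹ ∈ A.path y) :
    x = y ∨ (A.path x).card < (A.path y).card := by
  rw [card_path, card_path]
  simp only [path, List.mem_toFinset, List.mem_tails] at h
  rcases h.length_le.lt_or_eq with h' | h'
  · right; omega
  · exact Or.inl (inv_injective (A.normalForm_injective (h.eq_of_length h')))

theorem path_of_normalForm_inv_eq_cons {g : G} {a : α} {L : List α}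
    (h : A.normalForm g⁻¹ = a :: L) :
    A.path g = insert (A.normalForm g⁻¹) (A.path (g * A.letter a)) ∧
      A.normalForm g⁻¹ ∉ A.path (g * A.letter a) := by
  have hred := A.isReducedWord_normalForm g⁻¹
  have h' : A.normalForm (g * A.letter a)⁻¹ = L := by
    rw [mul_inv_rev, ← A.letter_inv, A.normalForm_letter_mul, h]
    simp [consReduce, A.inv_inv a]
  simp only [path, h', h, List.tails_cons, List.toFinset_cons, true_and, List.mem_toFinset,
    List.mem_tails]
  intro hs
  simpa using hs.length_le

/-- Right multiplication by a letter moves a vertex across exactly one edge of the tree. -/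
theorem card_symmDiff_path_letter (g : G) (a : α) :
    (symmDiff (A.path g) (A.path (g * A.letter a))).card = 1 := by
  have aux : ∀ (s : Finset (List α)) (x : List α), x ∉ s → (symmDiff (insert x s) s).card = 1 := by
    intro s x hx
    have : symmDiff (insert x s) s = {x} := by
      ext y
      simp only [Finset.mem_symmDiff, Finset.mem_insert, Finset.mem_singleton]
      constructor
      · tauto
      · rintro rfl; tauto
    rw [this, Finset.card_singleton]
  have hstep : A.normalForm (g * A.letter a)⁻¹ = consReduce A.inv (A.inv a) (A.normalForm g⁻¹) := by
    rw [mul_inv_rev, ← A.letter_inv, A.normalForm_letter_mul]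
  rcases consReduce_eq_cons_or (inv := A.inv) (A.inv a) (A.normalForm g⁻¹) with h | h
  · obtain ⟨h₁, h₂⟩ := A.path_of_normalForm_inv_eq_cons (hstep.trans h)
    rw [A.letter_inv, mul_inv_cancel_right] at h₁ h₂
    rw [symmDiff_comm, h₁, aux _ _ h₂]
  · rw [A.inv_inv a] at h
    obtain ⟨h₁, h₂⟩ := A.path_of_normalForm_inv_eq_cons h
    rw [h₁, aux _ _ h₂]

theorem card_symmDiff_path_le (x : G) (L : List α) :
    (symmDiff (A.path x) (A.path (x * A.eval L))).card ≤ L.length := by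
  induction L generalizing x with
  | nil => simp
  | cons a L ih =>
    rw [eval_cons, ← mul_assoc, List.length_cons]
    have h := Finset.card_le_card (symmDiff_triangle (A.path x) (A.path (x * A.letter a))
      (A.path (x * A.letter a * A.eval L)))
    have h' := Finset.card_union_le (symmDiff (A.path x) (A.path (x * A.letter a)))
      (symmDiff (A.path (x * A.letter a)) (A.path (x * A.letter a * A.eval L)))
    have := ih (x * A.letter a)
    have := A.card_symmDiff_path_letter x a
    rw [Finset.sup_eq_union] at h
    omega

/-- A vertex that is not on the path to `y` gets one step closer to `y` by moving to its parent. -/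
theorem exists_parent {x y : G} (hx : A.normalForm x⁻¹ ∉ A.path y) :
    ∃ a, (symmDiff (A.path (x * A.letter a)) (A.path y)).card + 1 =
      (symmDiff (A.path x) (A.path y)).card := by
  cases h : A.normalForm x⁻¹ with
  | nil => exact absurd (by simp [path, h]) hx
  | cons a L =>
    obtain ⟨h₁, h₂⟩ := A.path_of_normalForm_inv_eq_cons h
    refine ⟨a, ?_⟩
    have : symmDiff (A.path x) (A.path y) =
        insert (A.normalForm x⁻¹) (symmDiff (A.path (x * A.letter a)) (A.path y)) := by
      ext z
      rw [h₁]
      simp only [Finset.mem_symmDiff, Finset.mem_insert]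
      by_cases hz : z = A.normalForm x⁻¹
      · subst hz; tauto
      · tauto
    rw [this, Finset.card_insert_of_notMem]
    rw [Finset.mem_symmDiff]; tauto

/-- The geodesic from `x` to `y` in the tree, as a word in the letters. -/
theorem exists_eval_eq (x y : G) :
    ∃ L, A.eval L = x⁻¹ * y ∧ L.length ≤ (symmDiff (A.path x) (A.path y)).card := by
  induction hn : (symmDiff (A.path x) (A.path y)).card generalizing x y with
  | zero =>
    have hp : A.path x = A.path y := by
      rw [Finset.card_eq_zero] at hn
      exact symmDiff_eq_bot.mp hn
    rcases A.eq_or_card_path_lt (hp ▸ A.normalForm_mem_path x) with rfl | h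
    · exact ⟨[], by simp⟩
    · rw [hp] at h; omega
  | succ n ih =>
    by_cases hx : A.normalForm x⁻¹ ∈ A.path y
    · by_cases hy : A.normalForm y⁻¹ ∈ A.path x
      · rcases A.eq_or_card_path_lt hx with rfl | h
        · simp at hn
        · rcases A.eq_or_card_path_lt hy with rfl | h'
          · simp at hn
          · omega
      · obtain ⟨a, ha⟩ := A.exists_parent hy
        rw [symmDiff_comm, symmDiff_comm (A.path y)] at ha
        obtain ⟨L, hL, hl⟩ := ih x (y * A.letter a) (by omega)
        refine ⟨L ++ [A.inv a], ?_, by simpa using hl⟩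
        rw [eval_append, hL, eval_cons, eval_nil, A.letter_inv]
        group
    · obtain ⟨a, ha⟩ := A.exists_parent hx
      obtain ⟨L, hL, hl⟩ := ih (x * A.letter a) y (by omega)
      refine ⟨a :: L, ?_, by simpa using hl⟩
      rw [eval_cons, hL]
      group

/-- The word metric is the metric of the tree of reduced words. -/
theorem wordDist_eq {S : Set G} (hS : ∀ g, g ∈ S ∨ g⁻¹ ∈ S ↔ g ∈ Set.range A.letter) (x y : G) :
    wordDist S x y = (symmDiff (A.path x) (A.path y)).card := by
  have hword : ∀ L : List α, ∀ g ∈ L.map A.letter, g ∈ S ∨ g⁻¹ ∈ S := by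
    intro L g hg
    rw [hS]
    obtain ⟨a, -, rfl⟩ := List.mem_map.mp hg
    exact ⟨a, rfl⟩
  apply le_antisymm
  · obtain ⟨L, hL, hl⟩ := A.exists_eval_eq x y
    have := wordLength_le (hword L)
    rw [List.length_map] at this
    rw [wordDist, ← hL]
    exact this.trans hl
  · refine le_csInf ⟨_, _, hword _, A.eval_normalForm (x⁻¹ * y), rfl⟩ ?_
    rintro n ⟨w, hw, hxy, rfl⟩
    have hw' : w ∈ Set.range (List.map A.letter) := by
      rw [Set.range_list_map]
      exact fun g hg => (hS g).mp (hw g hg)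
    obtain ⟨L, rfl⟩ := hw'
    have := A.card_symmDiff_path_le x L
    rwa [eval, hxy, mul_inv_cancel_left, ← List.length_map A.letter] at this

theorem isCondStrictlyNegDef_wordDist {S : Set G}
    (hS : ∀ g, g ∈ S ∨ g⁻¹ ∈ S ↔ g ∈ Set.range A.letter) :
    IsCondStrictlyNegDef (fun x y : G => (wordDist S x y : ℂ)) := by
  simp only [A.wordDist_eq hS]
  exact isCondStrictlyNegDef_card_symmDiff A.path (fun x => A.normalForm x⁻¹)
    A.normalForm_mem_path fun _ _ => A.eq_or_card_path_lt

/-! ### Torsion -/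

theorem eval_flatten_replicate (L : List α) (n : ℕ) :
    A.eval (List.replicate n L).flatten = A.eval L ^ n := by
  induction n with
  | zero => simp
  | succ n ih => rw [List.replicate_succ, List.flatten_cons, eval_append, ih, pow_succ']

/-- If all letters are involutions, then a nonempty reduced word of finite order has odd length:
after cancelling equal first and last letters, which amounts to a conjugation, either a single
letter remains, or all powers of the remaining word are reduced. -/
theorem odd_length_of_eval_pow_eq_one (hid : ∀ a, A.inv a = a) {n : ℕ} (hn : n ≠ 0) (L : List α)
    (hL : IsReducedWord A.inv L) (hne : L ≠ []) (hpow : A.eval L ^ n = 1) : Odd L.length := by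
  induction L using List.bidirectionalRec with
  | nil => exact absurd rfl hne
  | singleton a => simp
  | cons_append a L b ih =>
    have hsq : ∀ a, A.letter a * A.letter a = 1 := fun a => by
      nth_rw 1 [← hid a]
      rw [A.letter_inv, inv_mul_cancel]
    by_cases hab : b = a
    · subst hab
      have hconj : A.eval (b :: (L ++ [b])) = A.letter b * A.eval L * (A.letter b)⁻¹ := by
        rw [eval_cons, eval_append, eval_cons, eval_nil, mul_one, ← mul_assoc,
          ← A.letter_inv, hid]
      rw [hconj, conj_pow, conj_eq_one_iff] at hpow
      have hL' : L ≠ [] := by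
        rintro rfl
        exact (List.isChain_cons_cons.mp hL).1 (hid b).symm
      have := ih (List.IsChain.left_of_append (List.IsChain.tail hL)) hL' hpow
      simpa [parity_simps] using this
    · exfalso
      obtain ⟨k, rfl⟩ := Nat.exists_eq_succ_of_ne_zero hn
      have hred : ∀ k, IsReducedWord A.inv (List.replicate k (a :: (L ++ [b]))).flatten := by
        intro k
        induction k with
        | zero => exact List.isChain_nil
        | succ k ihk =>
          rw [List.replicate_succ, List.flatten_cons]
          refine List.IsChain.append hL ihk ?_
          intro x hx y hy
          have hx' : x = b := by
            rw [← List.cons_append] at hx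
            simpa only [List.getLast?_concat, Option.mem_some, eq_comm] using hx
          have hy' : y = a := by
            cases k with
            | zero => simp at hy
            | succ k => simpa [List.replicate_succ, eq_comm] using hy
          rw [hx', hy', hid]
          exact Ne.symm hab
      have := A.normalForm_eval (hred (k + 1))
      rw [A.eval_flatten_replicate, hpow, A.normalForm_one] at this
      simp [List.replicate_succ] at this

end ReducedWordAction

/-! ### Alternating products -/

section AltProd

/-- An alternating product can also be peeled off at its last factor, which is `s` or `t` according
to parity. -/
theorem altProd_succ_right {G : Type*} [Monoid G] (s t : G) (k : ℕ) :
    ∃ u, (u = s ∨ u = t) ∧ altProd s t (k + 1) = altProd s t k * u := by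
  induction k generalizing s t with
  | zero => exact ⟨s, Or.inl rfl, by simp [altProd]⟩
  | succ k ih =>
    obtain ⟨u, hu, h⟩ := ih t s
    exact ⟨u, hu.symm, by rw [altProd, h, ← mul_assoc, altProd]⟩

theorem altProd_two_mul {G : Type*} [Monoid G] (s t : G) (k : ℕ) :
    altProd s t (2 * k) = (s * t) ^ k := by
  induction k with
  | zero => simp [altProd]
  | succ k ih => rw [Nat.mul_succ, altProd, altProd, ih, pow_succ', mul_assoc]

theorem altProd_add {G : Type*} [Monoid G] (s t : G) (k l : ℕ) :
    altProd s t (k + l) =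
      altProd s t k * (if Even k then altProd s t l else altProd t s l) := by
  induction k generalizing s t with
  | zero => simp [altProd]
  | succ k ih =>
    rw [Nat.add_right_comm, altProd, ih, altProd, mul_assoc]
    simp only [Nat.even_add_one]
    split_ifs <;> simp_all

theorem map_altProd {G H F : Type*} [Monoid G] [Monoid H] [FunLike F G H] [MonoidHomClass F G H]
    (φ : F) (s t : G) (k : ℕ) : φ (altProd s t k) = altProd (φ s) (φ t) k := by
  induction k generalizing s t with
  | zero => exact map_one φ
  | succ k ih => rw [altProd, altProd, map_mul, ih]

theorem mul_pow_eq_of_altProd_eq {G : Type*} [Monoid G] {s t : G} {m : ℕ}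
    (h : altProd s t m = altProd t s m) : (s * t) ^ m = (t * s) ^ m := by
  rw [← altProd_two_mul, ← altProd_two_mul, two_mul, altProd_add, altProd_add, h]

end AltProd

/-! ### The geometric representation -/

namespace CoxeterMatrix

variable {B : Type*} (M : CoxeterMatrix B)

/-- Twice the standard bilinear form of `M` against the basis vector `e i`, as a linear form on
`B →₀ ℝ`. As `π / 0 = 0`, an infinite entry, encoded as `0`, gets the value `-2`. -/
noncomputable def coroot (i : B) : Module.Dual ℝ (B →₀ ℝ) :=
  Finsupp.linearCombination ℝ fun j => -2 * Real.cos (Real.pi / M i j)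

theorem coroot_single (i j : B) :
    M.coroot i (Finsupp.single j 1) = -2 * Real.cos (Real.pi / M i j) := by
  simp [coroot]

theorem coroot_self (i : B) : M.coroot i (Finsupp.single i 1) = 2 := by
  simp [coroot_single]

/-- The reflection of `B →₀ ℝ` attached to a simple generator. -/
noncomputable def geomReflection (i : B) : (B →₀ ℝ) ≃ₗ[ℝ] (B →₀ ℝ) :=
  Module.reflection (M.coroot_self i)

theorem coroot_mul_coroot (i j : B) :
    M.coroot i (Finsupp.single j 1) * M.coroot j (Finsupp.single i 1) - 2 =
      2 * Real.cos (2 * (Real.pi / M i j)) := by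
  rw [coroot_single, coroot_single, M.symmetric j i, Real.cos_two_mul]
  ring

theorem three_le_of_ne {i j : B} (hij : i ≠ j) (h0 : M i j ≠ 0) (h2 : M i j ≠ 2) : 3 ≤ M i j := by
  have := M.off_diagonal i j hij
  omega

theorem two_le_of_ne {i j : B} (hij : i ≠ j) (h0 : M i j ≠ 0) : 2 ≤ M i j := by
  have := M.off_diagonal i j hij
  omega

theorem sin_two_mul_pi_div_pos {m : ℕ} (hm : 3 ≤ m) : 0 < Real.sin (2 * (Real.pi / m)) := by
  have hm' : (3 : ℝ) ≤ m := by exact_mod_cast hm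
  apply Real.sin_pos_of_pos_of_lt_pi
  · positivity
  · rw [mul_div_assoc', div_lt_iff₀ (by linarith)]
    nlinarith [Real.pi_pos]

open Polynomial.Chebyshev in
/-- With `θ = 2π / m`, the values `sin ((a + 1) θ)` and `sin ((b + 1) θ)` cancel if `a + b + 2 = m`.
-/
theorem chebyshev_S_eval_add_eq_zero {m : ℕ} (hm : 3 ≤ m) {a b : ℤ} (hab : a + b + 2 = m) :
    (S ℝ a).eval (2 * Real.cos (2 * (Real.pi / m))) +
      (S ℝ b).eval (2 * Real.cos (2 * (Real.pi / m))) = 0 := by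
  have hs := sin_two_mul_pi_div_pos hm
  refine (mul_eq_zero_iff_right hs.ne').mp ?_
  have hm0 : (m : ℝ) ≠ 0 := by positivity
  rw [add_mul, S_two_mul_real_cos, S_two_mul_real_cos]
  have : ((a : ℝ) + 1) * (2 * (Real.pi / m)) = 2 * Real.pi - (b + 1) * (2 * (Real.pi / m)) := by
    have : (a : ℝ) = m - 2 - b := by
      have : (a : ℝ) + b + 2 = m := by exact_mod_cast hab
      linarith
    rw [this]; field_simp; ring
  rw [this, Real.sin_two_pi_sub]
  ring

open Polynomial.Chebyshev in
theorem geomReflection_mul_pow (i j : B) :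
    (M.geomReflection i * M.geomReflection j) ^ M i j = 1 := by
  by_cases hij : i = j
  · subst hij
    rw [M.diagonal, pow_one]
    rw [geomReflection, mul_eq_one_iff_eq_inv, Module.reflection_inv]
  by_cases h0 : M i j = 0
  · rw [h0, pow_zero]
  ext1 z
  unfold geomReflection
  rw [Module.reflection_mul_reflection_pow_apply _ _ _ _ _ rfl, M.coroot_mul_coroot i j]
  generalize hm : M i j = m at h0
  by_cases h2 : m = 2
  · subst h2
    have hij : M.coroot i (Finsupp.single j 1) = 0 := by simp [coroot_single, hm]
    have hji : M.coroot j (Finsupp.single i 1) = 0 := by simp [coroot_single, M.symmetric j i, hm]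
    have hc : 2 * (Real.pi / 2) = Real.pi := by ring
    norm_num [hij, hji, hc]
    module
  have h3 : 3 ≤ m := hm ▸ M.three_le_of_ne hij (hm ▸ h0) (hm ▸ h2)
  rcases Nat.even_or_odd' m with ⟨k, hk | hk⟩
  · have e₁ : ((m : ℤ) - 2) / 2 = k - 1 := by omega
    have e₂ : ((m : ℤ) - 1) / 2 = k - 1 := by omega
    have := chebyshev_S_eval_add_eq_zero h3 (a := k - 1) (b := k - 1) (by omega)
    have : (S ℝ ((k : ℤ) - 1)).eval (2 * Real.cos (2 * (Real.pi / m))) = 0 := by linarith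
    simp [e₁, e₂, this]
  · have e₁ : ((m : ℤ) - 2) / 2 = k - 1 := by omega
    have e₂ : ((m : ℤ) - 1) / 2 = k := by omega
    have e₃ : ((m : ℤ) - 3) / 2 = k - 1 := by omega
    have e₄ : (m : ℤ) / 2 = k := by omega
    have := chebyshev_S_eval_add_eq_zero h3 (a := k) (b := k - 1) (by omega)
    simp [e₁, e₂, e₃, e₄, this]

/-- In the geometric representation, the product of two distinct simple reflections has order
exactly `M i j`. -/
theorem geomReflection_mul_pow_ne_one {i j : B} (hij : i ≠ j) {n : ℕ} (hn : 0 < n)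
    (hnm : n < M i j) : (M.geomReflection i * M.geomReflection j) ^ n ≠ 1 := by
  have hji : j ≠ i := hij.symm
  intro h
  have hx := Module.reflection_mul_reflection_pow_apply_self (M.coroot_self i) (M.coroot_self j)
    n _ rfl
  have h' : (M.geomReflection i * M.geomReflection j) ^ n = 1 := h
  unfold geomReflection at h'
  rw [h', M.coroot_mul_coroot i j, LinearEquiv.coe_one, id] at hx
  have hxi := DFunLike.congr_fun hx i
  have hxj := DFunLike.congr_fun hx j
  simp [hij, hji, coroot_single, M.symmetric j i] at hxi hxj
  generalize M i j = m at *
  rcases (show 2 ≤ m by omega).eq_or_lt with rfl | hm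
  · obtain rfl : n = 1 := by omega
    have hc : 2 * (Real.pi / 2) = Real.pi := by ring
    norm_num [hc] at hxi
  have hm' : (3 : ℝ) ≤ m := by exact_mod_cast hm
  have hcos : 0 < Real.cos (Real.pi / m) := by
    apply Real.cos_pos_of_mem_Ioo
    constructor
    · have : 0 < Real.pi / m := by positivity
      linarith [Real.pi_pos]
    · exact div_lt_div_of_pos_left Real.pi_pos (by norm_num) (by linarith)
  have hS := hxj.resolve_right hcos.ne'
  rw [hS, add_zero] at hxi
  have hs := sin_two_mul_pi_div_pos hm
  have h₁ := Polynomial.Chebyshev.S_two_mul_real_cos (2 * (Real.pi / m)) n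
  have h₂ := Polynomial.Chebyshev.S_two_mul_real_cos (2 * (Real.pi / m)) (n - 1)
  rw [← hxi, one_mul] at h₁
  rw [hS, zero_mul] at h₂
  push_cast at h₁ h₂
  rw [sub_add_cancel] at h₂
  rw [add_mul, one_mul, Real.sin_add, ← h₂, zero_mul, zero_add] at h₁
  have hcos₁ : Real.cos (n * (2 * (Real.pi / m))) = 1 := by
    apply mul_right_cancel₀ hs.ne'
    rw [one_mul, ← h₁]
  have hn' : (0 : ℝ) < n := by exact_mod_cast hn
  have hnm' : (n : ℝ) < m := by exact_mod_cast hnm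
  have hpos : 0 < n * (2 * (Real.pi / m)) := by positivity
  have hlt : n * (2 * (Real.pi / m)) < 2 * Real.pi := by
    rw [show n * (2 * (Real.pi / m)) = (n / m) * (2 * Real.pi) by ring]
    have : (n : ℝ) / m < 1 := (div_lt_one (by linarith)).mpr hnm'
    nlinarith [Real.pi_pos]
  exact hpos.ne' ((Real.cos_eq_one_iff_of_lt_of_lt (by linarith [Real.pi_pos]) hlt).mp hcos₁)

/-- The geometric representation of the Coxeter group. -/
noncomputable def geomRep : M.Group →* ((B →₀ ℝ) ≃ₗ[ℝ] (B →₀ ℝ)) :=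
  M.toCoxeterSystem.lift ⟨M.geomReflection, M.geomReflection_mul_pow⟩

theorem geomRep_simple (i : B) : M.geomRep (M.simple i) = M.geomReflection i := by
  rw [← M.toCoxeterSystem_simple]
  exact M.toCoxeterSystem.lift_apply_simple M.geomReflection_mul_pow i

theorem simple_mul_simple_pow_ne_one {i j : B} (hij : i ≠ j) {n : ℕ} (hn : 0 < n)
    (hnm : n < M i j) : (M.simple i * M.simple j) ^ n ≠ 1 := by
  intro h
  apply M.geomReflection_mul_pow_ne_one hij hn hnm
  have h' := congrArg M.geomRep h
  rwa [map_pow, map_mul, map_one, M.geomRep_simple, M.geomRep_simple] at h'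

end CoxeterMatrix

namespace CoxeterMatrix

variable {B : Type*} (M : CoxeterMatrix B)

theorem simple_mul_self (i : B) : M.simple i * M.simple i = 1 := by
  rw [← M.toCoxeterSystem_simple]; exact M.toCoxeterSystem.simple_mul_simple_self i

theorem simple_inv (i : B) : (M.simple i)⁻¹ = M.simple i := by
  rw [← M.toCoxeterSystem_simple]; exact M.toCoxeterSystem.inv_simple i

theorem simple_mul_simple_pow (i j : B) : (M.simple i * M.simple j) ^ M i j = 1 := by
  rw [← M.toCoxeterSystem_simple]; exact M.toCoxeterSystem.simple_mul_simple_pow i j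

theorem closure_range_simple : Subgroup.closure (Set.range M.simple) = ⊤ := by
  rw [← M.toCoxeterSystem_simple]; exact M.toCoxeterSystem.subgroup_closure_range_simple

/-! ### The reflection cocycle -/

open Classical in
/-- The action of a simple generator on `W × ℤ/2ℤ`: it conjugates the first coordinate and
changes the second one exactly when the first one is the generator itself. -/
noncomputable def reflectionPerm (i : B) : Equiv.Perm (M.Group × ZMod 2) :=
  Function.Involutive.toPerm
    (fun p => (M.simple i * p.1 * M.simple i, p.2 + if p.1 = M.simple i then 1 else 0)) (by
      rintro ⟨t, ε⟩
      have h : M.simple i * t * M.simple i = M.simple i ↔ t = M.simple i := by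
        rw [mul_assoc, mul_eq_left, mul_eq_one_iff_eq_inv, M.simple_inv]
      have h' : M.simple i * (M.simple i * t * M.simple i) * M.simple i = t := by
        rw [← mul_assoc, ← mul_assoc, M.simple_mul_self, one_mul, mul_assoc, M.simple_mul_self,
          mul_one]
      simp only [h, h', Prod.mk.injEq, true_and]
      rw [add_assoc, CharTwo.add_self_eq_zero, add_zero])

open Classical in
theorem reflectionPerm_apply (i : B) (t : M.Group) (ε : ZMod 2) :
    M.reflectionPerm i (t, ε) =
      (M.simple i * t * M.simple i, ε + if t = M.simple i then 1 else 0) :=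
  rfl

theorem reflectionPerm_inv (i : B) : (M.reflectionPerm i)⁻¹ = M.reflectionPerm i :=
  rfl

open Classical in
/-- The inverse of an alternating word of length `k` changes the second coordinate by the number of
occurrences of `t` in the inversion sequence `(s i * s j) ^ l * s i`, `l < k`, of the word. -/
theorem altProd_reflectionPerm_inv_apply (i j : B) (k : ℕ) (t : M.Group) (ε : ZMod 2) :
    (altProd (M.reflectionPerm i) (M.reflectionPerm j) k)⁻¹ (t, ε) =
      ((altProd (M.simple i) (M.simple j) k)⁻¹ * t * altProd (M.simple i) (M.simple j) k,
        ε + ∑ l ∈ Finset.range k,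
          if t = (M.simple i * M.simple j) ^ l * M.simple i then 1 else 0) := by
  induction k generalizing i j t ε with
  | zero => simp [altProd]
  | succ k ih =>
    rw [altProd, mul_inv_rev, Equiv.Perm.mul_apply, M.reflectionPerm_inv, reflectionPerm_apply, ih,
      Finset.sum_range_succ', altProd, mul_inv_rev, M.simple_inv]
    refine Prod.ext (by simp only [mul_assoc]) ?_
    have h : ∀ l, M.simple i * t * M.simple i = (M.simple j * M.simple i) ^ l * M.simple j ↔
        t = (M.simple i * M.simple j) ^ (l + 1) * M.simple i := by
      intro l
      have : (M.simple i * M.simple j) ^ (l + 1) * M.simple i =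
          M.simple i * ((M.simple j * M.simple i) ^ l * M.simple j) * M.simple i := by
        rw [mul_pow_mul, pow_succ]
        simp only [mul_assoc]
      rw [this]
      constructor
      · intro h
        rw [← h, ← mul_assoc, ← mul_assoc, M.simple_mul_self, one_mul, mul_assoc,
          M.simple_mul_self, mul_one]
      · intro h
        rw [h, ← mul_assoc, ← mul_assoc, M.simple_mul_self, one_mul, mul_assoc,
          M.simple_mul_self, mul_one]
    simp only [h, pow_zero, one_mul]
    rw [add_assoc]
    exact congrArg _ (add_comm _ _)

/-- The inversion sequence of the word `(s i * s j) ^ m`, of length `2 * m`, runs twice through the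
same `m` elements, so that every element occurs an even number of times. -/
theorem reflectionPerm_mul_pow (i j : B) :
    (M.reflectionPerm i * M.reflectionPerm j) ^ M i j = 1 := by
  classical
  rw [← altProd_two_mul, ← inv_eq_one]
  ext1 ⟨t, ε⟩
  rw [altProd_reflectionPerm_inv_apply, altProd_two_mul, M.simple_mul_simple_pow, two_mul,
    Finset.sum_range_add]
  simp [pow_add, M.simple_mul_simple_pow, CharTwo.add_self_eq_zero]

/-- The action of the Coxeter group on `W × ℤ/2ℤ`, whose second coordinate records the parity of the
number of occurrences of a reflection in the inversion sequence of a word. -/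
noncomputable def reflectionRep : M.Group →* Equiv.Perm (M.Group × ZMod 2) :=
  M.toCoxeterSystem.lift ⟨M.reflectionPerm, M.reflectionPerm_mul_pow⟩

theorem reflectionRep_simple (i : B) : M.reflectionRep (M.simple i) = M.reflectionPerm i := by
  rw [← M.toCoxeterSystem_simple]
  exact M.toCoxeterSystem.lift_apply_simple M.reflectionPerm_mul_pow i

/-- The number of elements at which the second coordinate changes is at most the length of the
word. -/
theorem exists_finset_card_le_of_reflectionRep_ne (L : List B) :
    ∃ F : Finset M.Group, F.card ≤ L.length ∧ ∀ t ε,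
      (M.reflectionRep (L.map M.simple).prod⁻¹ (t, ε)).2 ≠ ε → t ∈ F := by
  classical
  induction L with
  | nil => exact ⟨∅, by simp⟩
  | cons i L ih =>
    obtain ⟨F, hF, h⟩ := ih
    refine ⟨insert (M.simple i) (F.image fun t => M.simple i * t * M.simple i), ?_, ?_⟩
    · have h₁ := Finset.card_insert_le (M.simple i) (F.image fun t => M.simple i * t * M.simple i)
      have h₂ : (F.image fun t => M.simple i * t * M.simple i).card ≤ F.card :=
        Finset.card_image_le
      rw [List.length_cons]; omega
    · intro t ε hne
      by_contra ht
      rw [Finset.mem_insert, not_or, Finset.mem_image] at ht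
      rw [List.map_cons, List.prod_cons, mul_inv_rev, map_mul, Equiv.Perm.mul_apply, M.simple_inv,
        M.reflectionRep_simple, reflectionPerm_apply, if_neg ht.1, add_zero] at hne
      refine ht.2 ⟨_, h _ _ hne, ?_⟩
      rw [← mul_assoc, ← mul_assoc, M.simple_mul_self, one_mul, mul_assoc, M.simple_mul_self,
        mul_one]

/-- The longest element of the dihedral subgroup generated by two simple generators has length `M i
j` in the whole Coxeter group, as it has `M i j` distinct inversions. -/
theorem le_length_of_prod_eq_altProd {i j : B} (hij : i ≠ j) (L : List B)
    (hL : (L.map M.simple).prod = altProd (M.simple i) (M.simple j) (M i j)) :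
    M i j ≤ L.length := by
  classical
  obtain ⟨F, hF, h⟩ := M.exists_finset_card_le_of_reflectionRep_ne L
  refine le_trans ?_ hF
  have hinj : ∀ k < M i j, ∀ l < M i j, (M.simple i * M.simple j) ^ k * M.simple i =
      (M.simple i * M.simple j) ^ l * M.simple i → k = l := by
    have aux : ∀ k l, k < l → l < M i j →
        (M.simple i * M.simple j) ^ k ≠ (M.simple i * M.simple j) ^ l := by
      intro k l hkl hl heq
      apply M.simple_mul_simple_pow_ne_one hij (n := l - k) (by omega) (by omega)
      rw [pow_sub _ hkl.le, heq, mul_inv_cancel]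
    intro k hk l hl heq
    have heq := mul_right_cancel heq
    rcases lt_trichotomy k l with h | h | h
    · exact absurd heq (aux k l h hl)
    · exact h
    · exact absurd heq.symm (aux l k h hk)
  rw [← Finset.card_range (M i j), ← Finset.card_image_of_injOn (s := Finset.range (M i j))
    (f := fun k => (M.simple i * M.simple j) ^ k * M.simple i)]
  · apply Finset.card_le_card
    intro t ht
    obtain ⟨k, hk, rfl⟩ := Finset.mem_image.mp ht
    rw [Finset.mem_range] at hk
    refine h _ 0 ?_
    rw [hL, map_inv, map_altProd, M.reflectionRep_simple, M.reflectionRep_simple,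
      altProd_reflectionPerm_inv_apply, Finset.sum_eq_single_of_mem k (Finset.mem_range.mpr hk)]
    · simp
    · intro l hl hne
      exact if_neg fun heq => hne (hinj k hk l (Finset.mem_range.mp hl) heq).symm
  · intro k hk l hl heq
    exact hinj k (by simpa using hk) l (by simpa using hl) heq

/-- `CoxeterSystem.alternatingWord i j k` ends with `j`, whereas `altProd` prescribes the first
factor; this explains the parity. -/
theorem altProd_simple_eq_wordProd (i j : B) (k : ℕ) :
    altProd (M.simple i) (M.simple j) k = M.toCoxeterSystem.wordProd
      (if Even k then CoxeterSystem.alternatingWord i j k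
        else CoxeterSystem.alternatingWord j i k) := by
  induction k generalizing i j with
  | zero => simp [altProd, CoxeterSystem.alternatingWord]
  | succ k ih =>
    rw [altProd, ih, ← M.toCoxeterSystem_simple, ← CoxeterSystem.wordProd_cons]
    by_cases hk : Even k <;>
      simp [hk, Nat.even_add_one, CoxeterSystem.alternatingWord_succ']

theorem altProd_simple_comm (i j : B) :
    altProd (M.simple i) (M.simple j) (M i j) = altProd (M.simple j) (M.simple i) (M i j) := by
  have h := M.toCoxeterSystem.wordProd_braidWord_eq i j
  unfold CoxeterSystem.braidWord at h
  rw [M.symmetric j i] at h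
  rw [altProd_simple_eq_wordProd, altProd_simple_eq_wordProd]
  split_ifs
  exacts [h, h.symm]

end CoxeterMatrix

/-! ### A finite coefficient produces a cycle of even length -/

/-- If a group over the Coxeter group satisfies the braid relation of a finite coefficient `m`, then
the two alternating products of length `m` bound a cycle of length `2 * m` in its Cayley graph,
which is long enough to violate strictness: lengths are bounded below by those in the Coxeter group.
-/
theorem not_isCondStrictlyNegDef_wordDist {B G : Type*} [Group G] (M : CoxeterMatrix B)
    (f : B → G) (hf : Subgroup.closure (Set.range f) = ⊤) (π : G →* M.Group)
    (hπ : ∀ i, π (f i) = M.simple i) {i j : B} (hij : i ≠ j) (h0 : M i j ≠ 0)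
    (hbraid : altProd (f i) (f j) (M i j) = altProd (f j) (f i) (M i j)) :
    ¬ IsCondStrictlyNegDef (fun x y : G => (wordDist (Set.range f) x y : ℂ)) := by
  have hlower : ∀ g, π g = altProd (M.simple i) (M.simple j) (M i j) →
      M i j ≤ wordLength (Set.range f) g := by
    intro g hg
    obtain ⟨w, hw, rfl, hlen⟩ := exists_word_length_eq_wordLength hf g
    have hw' : w.map π ∈ Set.range (List.map M.simple) := by
      rw [Set.range_list_map]
      intro x hx
      obtain ⟨a, ha, rfl⟩ := List.mem_map.mp hx
      rcases hw a ha with ⟨b, rfl⟩ | ⟨b, hb⟩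
      · exact ⟨b, (hπ b).symm⟩
      · refine ⟨b, ?_⟩
        rw [← hπ, hb, map_inv, ← inv_inv (π a), ← map_inv, ← hb, hπ, M.simple_inv, M.simple_inv]
    obtain ⟨L, hL⟩ := hw'
    have := M.le_length_of_prod_eq_altProd hij L (by rw [hL, ← hg, map_list_prod])
    rwa [← List.length_map M.simple, hL, List.length_map, hlen] at this
  have hupper : ∀ i j k, wordLength (Set.range f) (altProd (f i) (f j) k) ≤ k := by
    intro i j k
    suffices h : ∃ w : List G, (∀ a ∈ w, a ∈ Set.range f ∨ a⁻¹ ∈ Set.range f) ∧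
        w.prod = altProd (f i) (f j) k ∧ w.length = k by
      obtain ⟨w, hw, hp, hl⟩ := h
      rw [← hp, ← hl]
      exact wordLength_le hw
    induction k generalizing i j with
    | zero => exact ⟨[], by simp [altProd]⟩
    | succ k ih =>
      obtain ⟨w, hw, hp, hl⟩ := ih j i
      refine ⟨f i :: w, ?_, by simp [altProd, hp], by simp [hl]⟩
      rintro a (_ | ⟨_, ha⟩)
      · exact Or.inl ⟨i, rfl⟩
      · exact hw a ha
  have hm := M.two_le_of_ne hij h0
  obtain ⟨k, hk⟩ : ∃ k, M i j = k + 1 := ⟨M i j - 1, by omega⟩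
  have hletter : ∀ i, wordLength (Set.range f) (f i) ≤ 1 := fun i => by
    simpa [altProd] using hupper i i 1
  -- Four vertices of the cycle: `1`, its neighbour `s`, the antipode `Δ` of `1`, and the
  -- antipode of `s`, which is the neighbour of `Δ` on the path through `t`.
  refine not_isCondStrictlyNegDef_of_quadrilateral (wordDist (Set.range f)) wordDist_self
    (wordDist_comm hf) (a := 1) (b := f i) (c := altProd (f i) (f j) (M i j))
    (e := altProd (f j) (f i) k) (m := M i j) hm ?_ ?_ ?_ ?_ ?_ ?_
  · simpa [wordDist] using hletter i
  · rw [wordDist_comm hf, hbraid, hk, wordDist]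
    obtain ⟨u, hu, h⟩ := altProd_succ_right (f j) (f i) k
    rw [h, inv_mul_cancel_left]
    rcases hu with rfl | rfl
    exacts [hletter j, hletter i]
  · rw [hk, altProd, wordDist, inv_mul_cancel_left]
    exact Nat.succ_le_succ (hupper j i k)
  · rw [hk, wordDist, inv_one, one_mul]
    exact Nat.succ_le_succ (hupper j i k)
  · rw [wordDist, inv_one, one_mul]
    exact hlower _ (by rw [map_altProd, hπ, hπ])
  · rw [wordDist]
    apply hlower
    rw [map_mul, map_inv, map_altProd, hπ, hπ, M.simple_inv, hk, altProd]

/-! ### Coxeter groups without finite coefficients -/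

/-- The homomorphism from `ℤ/2ℤ` sending the generator to a given involution. -/
def zmodTwoHom {G : Type*} [Group G] (g : G) (hg : g * g = 1) : Multiplicative (ZMod 2) →* G :=
  AddMonoidHom.toMultiplicativeLeft (ZMod.lift 2 ⟨zmultiplesHom (Additive G) (Additive.ofMul g), by
    rw [zmultiplesHom_apply, ← ofMul_zpow, ofMul_eq_zero]
    exact (zpow_natCast g 2).trans ((pow_two g).trans hg)⟩)

theorem zmodTwoHom_ofAdd_one {G : Type*} [Group G] (g : G) (hg : g * g = 1) :
    zmodTwoHom g hg (Multiplicative.ofAdd 1) = g := by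
  have : (1 : ZMod 2) = ((1 : ℤ) : ZMod 2) := by simp
  rw [this]
  simp only [zmodTwoHom, AddMonoidHom.toMultiplicativeLeft_apply_apply, toAdd_ofAdd, ZMod.lift_coe]
  simp

theorem zmodTwo_hom_ext {G : Type*} [Group G] {φ ψ : Multiplicative (ZMod 2) →* G}
    (h : φ (Multiplicative.ofAdd 1) = ψ (Multiplicative.ofAdd 1)) : φ = ψ := by
  refine MonoidHom.ext fun x => ?_
  have hx : ∀ x : Multiplicative (ZMod 2), x = 1 ∨ x = Multiplicative.ofAdd 1 := by decide
  rcases hx x with rfl | rfl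
  · rw [map_one, map_one]
  · exact h

namespace CoxeterMatrix

variable {B : Type*} (M : CoxeterMatrix B)

theorem isLiftable_of_forall_eq_zero {G : Type*} [Monoid G] (hM : ∀ i j, i ≠ j → M i j = 0)
    {f : B → G} (hf : ∀ i, f i * f i = 1) : M.IsLiftable f := by
  intro i j
  by_cases hij : i = j
  · subst hij
    rw [M.diagonal, pow_one, hf]
  · rw [hM i j hij, pow_zero]

/-- The Coxeter group without finite off-diagonal coefficients is a free product of copies of
`ℤ/2ℤ`, one for each generator. -/
noncomputable def groupEquivCoprodI (hM : ∀ i j, i ≠ j → M i j = 0) :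
    M.Group ≃* Monoid.CoprodI (fun _ : B => Multiplicative (ZMod 2)) :=
  MonoidHom.toMulEquiv
    (M.toCoxeterSystem.lift
      ⟨fun i => Monoid.CoprodI.of (M := fun _ : B => Multiplicative (ZMod 2)) (i := i)
          (Multiplicative.ofAdd 1),
        M.isLiftable_of_forall_eq_zero hM fun i => by
          rw [← map_mul]; exact map_one _⟩)
    (Monoid.CoprodI.lift fun i => zmodTwoHom (M.simple i) (M.simple_mul_self i))
    (by
      apply M.toCoxeterSystem.ext_simple
      intro i
      rw [MonoidHom.comp_apply, CoxeterSystem.lift_apply_simple, Monoid.CoprodI.lift_of,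
        zmodTwoHom_ofAdd_one, MonoidHom.id_apply, M.toCoxeterSystem_simple])
    (by
      apply Monoid.CoprodI.ext_hom
      intro i
      apply zmodTwo_hom_ext
      rw [MonoidHom.comp_apply, MonoidHom.comp_apply, Monoid.CoprodI.lift_of, zmodTwoHom_ofAdd_one,
        ← M.toCoxeterSystem_simple, CoxeterSystem.lift_apply_simple]
      rfl)

/-- The action of a Coxeter group without finite off-diagonal coefficients on reduced words in its
simple generators. -/
noncomputable def reducedWordAction [DecidableEq B] (hM : ∀ i j, i ≠ j → M i j = 0) :
    ReducedWordAction M.Group B where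
  inv := id
  inv_inv := fun _ => rfl
  letter := M.simple
  letter_inv := fun i => (M.simple_inv i).symm
  closure_range_letter := M.closure_range_simple
  toPerm := M.toCoxeterSystem.lift ⟨letterPerm (inv := id) fun _ => rfl,
    M.isLiftable_of_forall_eq_zero hM fun i => by
      rw [mul_eq_one_iff_eq_inv]
      exact letterPerm_inv (inv := id) (fun _ => rfl) i⟩
  toPerm_letter := fun i => by
    rw [← M.toCoxeterSystem_simple, CoxeterSystem.lift_apply_simple]

theorem isCondStrictlyNegDef_wordDist (hM : ∀ i j, i ≠ j → M i j = 0) :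
    IsCondStrictlyNegDef (fun x y : M.Group => (wordDist (Set.range M.simple) x y : ℂ)) := by
  classical
  refine (M.reducedWordAction hM).isCondStrictlyNegDef_wordDist fun g => ?_
  have : g⁻¹ ∈ Set.range M.simple ↔ g ∈ Set.range M.simple :=
    exists_congr fun i => by rw [← M.simple_inv i, inv_inj, M.simple_inv]
  rw [this, or_self]
  rfl

/-- In a Coxeter group without finite coefficients, nontrivial torsion elements have odd length. -/
theorem lengthParity_eq_of_pow_eq_one (hM : ∀ i j, i ≠ j → M i j = 0) {g : M.Group} (hg : g ≠ 1)
    {n : ℕ} (hn : n ≠ 0) (hpow : g ^ n = 1) :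
    M.toCoxeterSystem.lengthParity g = Multiplicative.ofAdd 1 := by
  classical
  let A := M.reducedWordAction hM
  have hodd := A.odd_length_of_eval_pow_eq_one (fun _ => rfl) hn (A.normalForm g)
    (A.isReducedWord_normalForm g) (fun h => hg (by rw [← A.eval_normalForm g, h]; rfl))
    (by rwa [A.eval_normalForm])
  have hpar : ∀ L : List B, M.toCoxeterSystem.lengthParity (A.eval L) =
      Multiplicative.ofAdd (L.length : ZMod 2) := by
    intro L
    induction L with
    | nil => simp
    | cons i L ih =>
      rw [A.eval_cons, map_mul, ih]
      change M.toCoxeterSystem.lengthParity (M.simple i) * _ = _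
      rw [← M.toCoxeterSystem_simple, CoxeterSystem.lengthParity_simple, ← ofAdd_add,
        List.length_cons, Nat.cast_succ, add_comm]
  rw [← A.eval_normalForm g, hpar, (ZMod.natCast_eq_one_iff_odd).mpr hodd]

/-- In a free product of copies of `ℤ/2ℤ`, nontrivial torsion elements have odd length. Two distinct
generators `s`, `t` with a finite coefficient would give three such elements `s`, `t` and `s * t`,
which is impossible by parity. -/
theorem forall_eq_zero_of_isFreeCoxeterGroup (h : IsFreeCoxeterGroup M.Group) {i j : B}
    (hij : i ≠ j) : M i j = 0 := by
  classical
  obtain ⟨I, ⟨e⟩⟩ := h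
  let U : CoxeterMatrix I :=
    { M := fun a b => if a = b then 1 else 0
      isSymm := by ext a b; simp [Matrix.transpose, eq_comm]
      diagonal := by simp
      off_diagonal := by intro a b hab; simp [hab] }
  have hU : ∀ a b, a ≠ b → U a b = 0 := fun a b hab => if_neg hab
  let φ : M.Group ≃* U.Group := e.trans (U.groupEquivCoprodI hU).symm
  by_contra h0
  have hm := M.two_le_of_ne hij h0
  have hne : ∀ k, M.simple k ≠ 1 := by
    intro k hk
    have := M.toCoxeterSystem.lengthParity_simple k
    rw [M.toCoxeterSystem_simple, hk, map_one] at this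
    exact absurd this (by decide)
  have hpar : ∀ k, U.toCoxeterSystem.lengthParity (φ (M.simple k)) = Multiplicative.ofAdd 1 :=
    fun k => U.lengthParity_eq_of_pow_eq_one hU
      ((map_ne_one_iff φ φ.injective).mpr (hne k)) two_ne_zero
      (by rw [← map_pow, pow_two, M.simple_mul_self, map_one])
  have hne' : M.simple i * M.simple j ≠ 1 := by
    simpa using M.simple_mul_simple_pow_ne_one hij (n := 1) one_pos (by omega)
  have := U.lengthParity_eq_of_pow_eq_one hU ((map_ne_one_iff φ φ.injective).mpr hne') h0
    (by rw [← map_pow, M.simple_mul_simple_pow, map_one])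
  rw [map_mul, map_mul, hpar, hpar] at this
  exact absurd this (by decide)

end CoxeterMatrix

/-! ### Artin groups without finite coefficients -/

namespace ArtinGroup

variable {B : Type*} (M : CoxeterMatrix B)

theorem closure_artinGenerators : Subgroup.closure (artinGenerators M) = ⊤ :=
  PresentedGroup.closure_range_of _

theorem altProd_of_comm {s t : B} (hst : s ≠ t) (h0 : M s t ≠ 0) :
    altProd (PresentedGroup.of s : ArtinGroup M) (PresentedGroup.of t) (M s t) =
      altProd (PresentedGroup.of t) (PresentedGroup.of s) (M s t) := by
  have := PresentedGroup.mk_eq_mk_of_mul_inv_mem (rels := artinRelators M) ⟨s, t, hst, h0, rfl⟩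
  rwa [map_altProd, map_altProd] at this

/-- The homomorphism of an Artin group defined by a family satisfying the braid relations. -/
def lift {G : Type*} [Group G] (f : B → G)
    (hf : ∀ s t, s ≠ t → M s t ≠ 0 → altProd (f s) (f t) (M s t) = altProd (f t) (f s) (M s t)) :
    ArtinGroup M →* G :=
  PresentedGroup.toGroup (f := f) (by
    rintro r ⟨s, t, hst, h0, rfl⟩
    rw [map_mul, map_inv, map_altProd, map_altProd, FreeGroup.lift_apply_of,
      FreeGroup.lift_apply_of, hf s t hst h0, mul_inv_cancel])

theorem lift_of {G : Type*} [Group G] (f : B → G)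
    (hf : ∀ s t, s ≠ t → M s t ≠ 0 → altProd (f s) (f t) (M s t) = altProd (f t) (f s) (M s t))
    (s : B) : lift M f hf (PresentedGroup.of s) = f s :=
  PresentedGroup.toGroup.of _

/-- The canonical projection from the Artin group onto the Coxeter group. -/
def toCoxeterGroup : ArtinGroup M →* M.Group :=
  lift M M.simple fun s t _ _ => M.altProd_simple_comm s t

/-- The homomorphism to `ℤ` sending every standard generator to `1`. -/
def exponentSum : ArtinGroup M →* Multiplicative ℤ :=
  lift M (fun _ => Multiplicative.ofAdd 1) fun _ _ _ _ => rfl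

theorem isFreeGroup (hM : ∀ i j, i ≠ j → M i j = 0) : IsFreeGroup (ArtinGroup M) := by
  let φ : ArtinGroup M →* FreeGroup B :=
    lift M FreeGroup.of fun s t hst h0 => absurd (hM s t hst) h0
  exact IsFreeGroup.ofMulEquiv (MonoidHom.toMulEquiv
    (FreeGroup.lift (PresentedGroup.of : B → ArtinGroup M)) φ
    (by ext; simp [φ, lift_of]) (by ext; simp [φ, lift_of]))

/-- The action of an Artin group without finite coefficients on reduced words in its generators and
their inverses, the letters `(s, true)` and `(s, false)`. -/
noncomputable def reducedWordAction [DecidableEq B] (hM : ∀ i j, i ≠ j → M i j = 0) :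
    ReducedWordAction (ArtinGroup M) (B × Bool) where
  inv a := (a.1, !a.2)
  inv_inv a := by simp
  letter a := if a.2 then PresentedGroup.of a.1 else (PresentedGroup.of a.1)⁻¹
  letter_inv := by rintro ⟨s, _ | _⟩ <;> simp
  closure_range_letter := by
    rw [eq_top_iff, ← closure_artinGenerators M]
    apply Subgroup.closure_mono
    rintro _ ⟨s, rfl⟩
    exact ⟨(s, true), rfl⟩
  toPerm := lift M (fun s => letterPerm (inv := fun a : B × Bool => (a.1, !a.2))
    (fun a => by simp) (s, true)) fun s t hst h0 => absurd (hM s t hst) h0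
  toPerm_letter := by
    rintro ⟨s, _ | _⟩
    · simp only [Bool.false_eq_true, if_false, map_inv, lift_of]
      exact (letterPerm_inv (inv := fun a : B × Bool => (a.1, !a.2)) (fun a => by simp)
        (s, true)).symm
    · simp only [if_true, lift_of]

theorem isCondStrictlyNegDef_wordDist (hM : ∀ i j, i ≠ j → M i j = 0) :
    IsCondStrictlyNegDef (fun x y : ArtinGroup M => (wordDist (artinGenerators M) x y : ℂ)) := by
  classical
  refine (reducedWordAction M hM).isCondStrictlyNegDef_wordDist fun g => ?_
  constructor
  · rintro (⟨s, rfl⟩ | ⟨s, hs⟩)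
    · exact ⟨(s, true), rfl⟩
    · exact ⟨(s, false), by rw [← inv_inv g, ← hs]; rfl⟩
  · rintro ⟨⟨s, _ | _⟩, rfl⟩
    · exact Or.inr ⟨s, (inv_inv _).symm⟩
    · exact Or.inl ⟨s, rfl⟩

end ArtinGroup

/-! ### Commuting elements of free groups -/

theorem IsFreeGroup.isMulTorsionFree (G : Type*) [Group G] [IsFreeGroup G] : IsMulTorsionFree G :=
  Function.Injective.isMulTorsionFree (IsFreeGroup.toFreeGroup G).toMonoidHom
    (IsFreeGroup.toFreeGroup G).injective

/-- Two distinct elements of a basis do not commute, as they may be sent to two transpositions of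
three points. So a commutative free group has rank at most one. -/
theorem IsFreeGroup.isCyclic_of_comm (G : Type*) [Group G] [IsFreeGroup G]
    (hcomm : ∀ x y : G, x * y = y * x) : IsCyclic G := by
  have hsub : Subsingleton (IsFreeGroup.Generators G) := by
    classical
    refine ⟨fun i j => ?_⟩
    by_contra hij
    let φ : G →* Equiv.Perm (Fin 3) :=
      IsFreeGroup.lift fun k => if k = i then Equiv.swap 0 1 else Equiv.swap 1 2
    have h := congrArg φ (hcomm (IsFreeGroup.of i) (IsFreeGroup.of j))
    rw [map_mul, map_mul, IsFreeGroup.lift_of, IsFreeGroup.lift_of, if_pos rfl,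
      if_neg (Ne.symm hij)] at h
    exact absurd h (by decide)
  suffices h : IsCyclic (FreeGroup (IsFreeGroup.Generators G)) from
    isCyclic_of_surjective (IsFreeGroup.mulEquiv G) (IsFreeGroup.mulEquiv G).surjective
  rcases isEmpty_or_nonempty (IsFreeGroup.Generators G) with _ | ⟨⟨i⟩⟩
  · infer_instance
  · refine ⟨FreeGroup.of i, fun x => ?_⟩
    have : Set.range (FreeGroup.of : IsFreeGroup.Generators G → _) = {FreeGroup.of i} := by
      ext y
      constructor
      · rintro ⟨k, rfl⟩
        rw [Subsingleton.elim k i]; rfl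
      · rintro rfl
        exact ⟨i, rfl⟩
    change x ∈ Subgroup.zpowers (FreeGroup.of i)
    rw [Subgroup.zpowers_eq_closure, ← this, FreeGroup.closure_range_of]
    trivial

namespace ArtinGroup

variable {B : Type*} (M : CoxeterMatrix B)

/-- In a free Artin group, two generators with a finite coefficient would commute, hence be powers
of a common element, hence be equal since both have exponent sum `1`. -/
theorem forall_eq_zero_of_isFreeGroup [IsFreeGroup (ArtinGroup M)] {i j : B} (hij : i ≠ j) :
    M i j = 0 := by
  by_contra h0
  have hm := M.two_le_of_ne hij h0
  set s : ArtinGroup M := PresentedGroup.of i with hs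
  set t : ArtinGroup M := PresentedGroup.of j with ht
  have := IsFreeGroup.isMulTorsionFree (ArtinGroup M)
  -- `(s * t) ^ m = (t * s) ^ m` holds in every Artin group, and roots are unique in a free group.
  have hcomm : s * t = t * s :=
    pow_left_injective h0 (mul_pow_eq_of_altProd_eq (altProd_of_comm M hij h0))
  let H : Subgroup (ArtinGroup M) := Subgroup.closure {s, t}
  have hH : ∀ x y : H, x * y = y * x := by
    have := Subgroup.isMulCommutative_closure (k := {s, t}) (by
      rintro x (rfl | rfl) y (rfl | rfl)
      exacts [rfl, hcomm, hcomm.symm, rfl])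
    exact fun x y => this.is_comm.comm x y
  obtain ⟨z, hz⟩ := IsFreeGroup.isCyclic_of_comm H hH
  obtain ⟨a, ha⟩ := hz ⟨s, Subgroup.subset_closure (by simp)⟩
  obtain ⟨b, hb⟩ := hz ⟨t, Subgroup.subset_closure (by simp)⟩
  have ha' : (z : ArtinGroup M) ^ a = s := congrArg Subtype.val ha
  have hb' : (z : ArtinGroup M) ^ b = t := congrArg Subtype.val hb
  have hza : a * (exponentSum M z).toAdd = 1 := by
    have := congrArg (fun x => (exponentSum M x).toAdd) ha'
    simpa [hs, exponentSum, lift_of] using this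
  have hzb : b * (exponentSum M z).toAdd = 1 := by
    have := congrArg (fun x => (exponentSum M x).toAdd) hb'
    simpa [ht, exponentSum, lift_of] using this
  have hab : a = b := by
    have hz0 : (exponentSum M z).toAdd ≠ 0 := by
      intro h; rw [h] at hza; simp at hza
    exact mul_right_cancel₀ hz0 (hza.trans hzb.symm)
  have hst : s = t := by rw [← ha', ← hb', hab]
  have hst' := congrArg (toCoxeterGroup M) hst
  rw [hs, ht, toCoxeterGroup, lift_of, lift_of] at hst'
  apply M.simple_mul_simple_pow_ne_one hij (n := 1) one_pos (by omega)
  rw [pow_one, hst', M.simple_mul_self]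

end ArtinGroup

/-! ### The two equivalences -/

theorem theorem2 {B : Type*} (M : CoxeterMatrix B) :
    (IsCondStrictlyNegDef
        (fun x y : M.Group => (wordDist (Set.range M.simple) x y : ℂ)) ↔
      IsFreeCoxeterGroup M.Group) ∧
    (IsCondStrictlyNegDef
        (fun x y : ArtinGroup M => (wordDist (artinGenerators M) x y : ℂ)) ↔
      IsFreeGroup (ArtinGroup M)) := by
  refine ⟨⟨fun h => ⟨B, ⟨M.groupEquivCoprodI fun i j hij => ?_⟩⟩, fun h =>
    M.isCondStrictlyNegDef_wordDist fun i j => M.forall_eq_zero_of_isFreeCoxeterGroup h⟩,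
    ⟨fun h => ArtinGroup.isFreeGroup M fun i j hij => ?_, fun h =>
    ArtinGroup.isCondStrictlyNegDef_wordDist M fun i j =>
      ArtinGroup.forall_eq_zero_of_isFreeGroup M⟩⟩
  · by_contra h0
    exact not_isCondStrictlyNegDef_wordDist M M.simple M.closure_range_simple (MonoidHom.id _)
      (fun _ => rfl) hij h0 (M.altProd_simple_comm i j) h
  · by_contra h0
    exact not_isCondStrictlyNegDef_wordDist M PresentedGroup.of
      (ArtinGroup.closure_artinGenerators M) (ArtinGroup.toCoxeterGroup M)
      (ArtinGroup.lift_of M _ _) hij h0 (ArtinGroup.altProd_of_comm M hij h0) h
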